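/- Let $p>2$ be a prime, $\zeta_p$ a primitive $p$-th root of unity, $K=\mathbb{Q}(\zeta_p)$, and $\mathfrak{p}$ the unique prime ideal of $K$ above $p$. For a prime $\ell\equiv 1 \pmod p$, let $\xi_\ell$ be a primitive $\ell$-th root of unity, let $F_\ell$ be the subfield of $\mathbb{Q}(\xi_\ell)$ of degree $p$ over $\mathbb{Q}$, and let $R_\ell\in\mathbb{F}_p[x]$ be the reduction modulo $p$ of the polynomial $$Q_\ell=\prod_{\sigma\in\mathrm{Gal}(F_\ell/\mathbb{Q})}\bigl(x-\sigma(\mathrm{Tr}_{\mathbb{Q}(\xi_\ell)/F_\ell}(\xi_\ell))\bigr)\in\mathbb{Z}[x].$$ For a character $\psi$ of $\mathbb{F}_\ell^\times$ of order $p$, put $\tau(\psi)=-\sum_{x\in\mathbb{F}_\ell^\times}\psi(x)\,\xi_\ell^x$. Let $\ell_1,\ell_2\equiv 1\pmod p$ be primes, let $g_i$ be a primitive root modulo $\ell_i$, and let $\psi_i$ be the character of $\mathbb{F}_{\ell_i}^\times$ of order $p$ with $\psi_i(g_i)=\zeta_p$ ($i=1,2$). Let $F=F_{\ell_1}F_{\ell_2}$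 and let $Z_{FK}$ be the ring of integers of $FK$. Then $\tau(\psi_1),\tau(\psi_2)\in Z_{FK}$ and, if $R_{\ell_1}\neq R_{\ell_2}$, then for every $\sigma\in\mathrm{Gal}(FK/\mathbb{Q})$, $$\tau(\psi_2)\not\equiv\tau(\psi_1)^{\sigma}\pmod{\mathfrak{p}^p Z_{FK}}.$$ -/

import Mathlib

open Polynomial IntermediateField NumberField

noncomputable section

/-- The relative trace `Tr_{ℚ(ξ)/F}(ξ)`, as an element of the subextension `F` of `ℚ(ξ)/ℚ`. -/
def relTrace {Ω : Type*} [Field Ω] [CharZero Ω] (ξ : Ω) (F : IntermediateField ℚ ℚ⟮ξ⟯) : F :=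
  Algebra.trace F ℚ⟮ξ⟯ (AdjoinSimple.gen ℚ ξ)

/-- The polynomial `∏_{σ ∈ Gal(F/ℚ)} (X - σ(Tr_{ℚ(ξ)/F}(ξ)))`, with coefficients in `F`. -/
def conjPoly {Ω : Type*} [Field Ω] [CharZero Ω] (ξ : Ω) (F : IntermediateField ℚ ℚ⟮ξ⟯) : F[X] :=
  ∏ᶠ σ : Gal(F/ℚ), (X - C (σ (relTrace ξ F)))

/-- When `ξ` is a root of unity, `conjPoly ξ F` has integer coefficients. -/
theorem exists_int_conjPoly {Ω : Type*} [Field Ω] [CharZero Ω] {n : ℕ} (hn : n ≠ 0) {ξ : Ω}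
    (hξ : IsPrimitiveRoot ξ n) (F : IntermediateField ℚ ℚ⟮ξ⟯) :
    ∃ Q : ℤ[X], Q.map (Int.castRingHom F) = conjPoly ξ F := by
  have : NeZero n := ⟨hn⟩
  have : IsCyclotomicExtension {n} ℚ ℚ⟮ξ⟯ := by
    change IsCyclotomicExtension {n} ℚ ℚ⟮ξ⟯.toSubalgebra
    rw [adjoin_simple_toSubalgebra_of_isAlgebraic
      ((hξ.isIntegral (Nat.pos_of_ne_zero hn)).tower_top (A := ℚ)).isAlgebraic]
    exact hξ.adjoin_isCyclotomicExtension ℚ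
  have : NumberField ℚ⟮ξ⟯ := IsCyclotomicExtension.numberField {n} ℚ _
  have : IsAbelianGalois ℚ ℚ⟮ξ⟯ := IsCyclotomicExtension.isAbelianGalois {n} ℚ _
  have : FiniteDimensional ℚ F := inferInstance
  have : NumberField F := {}
  have hint : IsIntegral ℤ (AdjoinSimple.gen ℚ ξ) := by
    refine IsIntegral.of_pow (Nat.pos_of_ne_zero hn) ?_
    have : (AdjoinSimple.gen ℚ ξ) ^ n = 1 := by
      apply Subtype.ext
      simpa using hξ.pow_eq_one
    rw [this]
    exact isIntegral_one
  have ht : IsIntegral ℤ (relTrace ξ F) := Algebra.isIntegral_trace hint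
  have : IsAbelianGalois ℚ F := IsAbelianGalois.tower_bot ℚ F ℚ⟮ξ⟯
  have : IsGaloisGroup Gal(F/ℚ) ℚ F := inferInstance
  have : IsGaloisGroup Gal(F/ℚ) ℤ (𝓞 F) := inferInstance
  obtain ⟨t, ht⟩ : ∃ t : 𝓞 F, (t : F) = relTrace ξ F :=
    ⟨⟨relTrace ξ F, ht⟩, rfl⟩
  obtain ⟨Q, hQ⟩ := (mem_lifts _).mp
    (Algebra.IsInvariant.charpoly_mem_lifts ℤ (𝓞 F) Gal(F/ℚ) t)
  refine ⟨Q, ?_⟩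
  have h2 := congrArg (Polynomial.map (algebraMap (𝓞 F) F)) hQ
  rw [Polynomial.map_map, MulSemiringAction.charpoly_eq, Polynomial.map_prod,
    RingHom.ext_int ((algebraMap (𝓞 F) F).comp _) (Int.castRingHom F)] at h2
  rw [conjPoly, finprod_eq_prod_of_fintype, h2, ← ht]
  refine Finset.prod_congr rfl fun σ _ => ?_
  simp only [Polynomial.map_sub, map_X, map_C]
  rfl

open Classical in
/-- `conjPoly ξ F` as a polynomial in `ℤ[X]` (the lift is unique, because `ℤ → F` is injective, and
exists by `exists_int_conjPoly`). -/
def intPoly {Ω : Type*} [Field Ω] [CharZero Ω] (ξ : Ω) (F : IntermediateField ℚ ℚ⟮ξ⟯) : ℤ[X] :=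
  if h : ∃ Q : ℤ[X], Q.map (Int.castRingHom F) = conjPoly ξ F then h.choose else 0

theorem map_intPoly {Ω : Type*} [Field Ω] [CharZero Ω] {n : ℕ} (hn : n ≠ 0) {ξ : Ω}
    (hξ : IsPrimitiveRoot ξ n) (F : IntermediateField ℚ ℚ⟮ξ⟯) :
    (intPoly ξ F).map (Int.castRingHom F) = conjPoly ξ F := by
  have h := exists_int_conjPoly hn hξ F
  rw [intPoly, dif_pos h]
  exact h.choose_spec

/-- The reduction modulo `p` of the integer polynomial whose roots are the conjugates of
`Tr_{ℚ(ξ)/F}(ξ)`. -/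
def redPoly (p : ℕ) {Ω : Type*} [Field Ω] [CharZero Ω] (ξ : Ω) (F : IntermediateField ℚ ℚ⟮ξ⟯) :
    (ZMod p)[X] :=
  (intPoly ξ F).map (Int.castRingHom (ZMod p))

/-- The Gauss sum `τ(ψ) = - ∑_{x ∈ 𝔽_ℓˣ} ψ(x) ξ^x`. -/
def tau {ℓ : ℕ} [Fact ℓ.Prime] {Ω : Type*} [Field Ω] (ψ : (ZMod ℓ)ˣ →* Ω) (ξ : Ω) : Ω :=
  -∑ x : (ZMod ℓ)ˣ, ψ x * ξ ^ (x : ZMod ℓ).val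

/-- The compositum `F₁F₂K` inside `Ω`, where `K = ℚ(ζ)`. -/
abbrev compositumFK {Ω : Type*} [Field Ω] [CharZero Ω] (ζ : Ω) {ξ₁ ξ₂ : Ω}
    (F₁ : IntermediateField ℚ ℚ⟮ξ₁⟯) (F₂ : IntermediateField ℚ ℚ⟮ξ₂⟯) : IntermediateField ℚ Ω :=
  IntermediateField.lift F₁ ⊔ IntermediateField.lift F₂ ⊔ ℚ⟮ζ⟯

/-- The ring homomorphism `Z_K → Z_{F₁F₂K}` given by the inclusion of `K = ℚ(ζ)`. -/
def inclFK {Ω : Type*} [Field Ω] [CharZero Ω] (ζ : Ω) {ξ₁ ξ₂ : Ω}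
    (F₁ : IntermediateField ℚ ℚ⟮ξ₁⟯) (F₂ : IntermediateField ℚ ℚ⟮ξ₂⟯) :
    𝓞 ℚ⟮ζ⟯ →+* 𝓞 (compositumFK ζ F₁ F₂) :=
  RingOfIntegers.mapRingHom
    (IntermediateField.inclusion (le_sup_right : ℚ⟮ζ⟯ ≤ compositumFK ζ F₁ F₂))

end

/-!
Sorting the terms of `τ(ψ)` by the value of `ψ` gives `τ(ψ) = -∑ ε * η_ε`, where `ε` runs over the
`p`-th roots of unity and the `η_ε` are the Gaussian periods, whose sum is `-1`. The roots of `Q_ℓ`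
are exactly these periods, whichever character of order `p` and primitive `ℓ`-th root of unity
define them, and every conjugate of a Gauss sum is again such a Gauss sum. So a congruence modulo
`𝔭 ^ p` becomes `(ζ - 1) ^ p ∣ ∑ i < p, ζ ^ i * c i`, where `c i` is a difference of periods and
`∑ c i = 0`.

The `c i` lie in the ring generated by roots of unity of order prime to `p`. That ring is unramified
at `p`: an iterate of Frobenius fixes it modulo `p`, so an element divisible by `ζ - 1` is divisible
by `p`. Put `π = ζ - 1` and expand `∑ c i * (1 + π) ^ i` in powers of `π`. The constant term
vanishes, and the other coefficients are shown to be divisible by `p` one after the other, as `p` is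
associated to `π ^ (p - 1)`. Hence `p` divides every `c i`, and the period polynomials agree
modulo `p`.
-/

theorem dvd_pow_prime_pow_sub_self_of_mem_adjoin {B : Type*} [CommRing B] {p : ℕ} [Fact p.Prime]
    (m : ℕ) {S : Set B} (hS : ∀ s ∈ S, s ^ p ^ m = s) {a : B} (ha : a ∈ Algebra.adjoin ℤ S) :
    (p : B) ∣ a ^ p ^ m - a := by
  by_cases hu : IsUnit (p : B)
  · exact hu.dvd
  have : CharP (B ⧸ Ideal.span {(p : B)}) p := CharP.quotient B p hu
  have : ExpChar (B ⧸ Ideal.span {(p : B)}) p := .prime Fact.out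
  rw [← Ideal.mem_span_singleton, ← Ideal.Quotient.eq, map_pow, ← iterateFrobenius_def]
  induction ha using Algebra.adjoin_induction with
  | mem s hs => rw [iterateFrobenius_def, ← map_pow, hS s hs]
  | algebraMap n => simp
  | add x y _ _ hx hy => rw [map_add, map_add, hx, hy]
  | mul x y _ _ hx hy => rw [map_mul, map_mul, hx, hy]

theorem natCast_dvd_of_dvd_of_mem_adjoin {B : Type*} [CommRing B] {p n : ℕ} [hp : Fact p.Prime]
    (hpn : p.Coprime n) {S : Set B} (hS : ∀ s ∈ S, s ^ n = 1) {π : B} (hπ : (p : B) ∣ π ^ p)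
    {a : B} (ha : a ∈ Algebra.adjoin ℤ S) (hdvd : π ∣ a) : (p : B) ∣ a := by
  obtain rfl | hn := n.eq_zero_or_pos
  · exact absurd (Nat.coprime_zero_right p |>.mp hpn) hp.out.ne_one
  have hfix : ∀ s ∈ S, s ^ p ^ n.totient = s := fun s hs => by
    rw [pow_eq_pow_mod _ (hS s hs), (Nat.ModEq.pow_totient hpn : _ % n = 1 % n),
      ← pow_eq_pow_mod _ (hS s hs), pow_one]
  have hle : p ≤ p ^ n.totient := Nat.le_self_pow (Nat.totient_pos.mpr hn).ne' p
  refine (dvd_sub_right ?_).mp (dvd_pow_prime_pow_sub_self_of_mem_adjoin n.totient hfix ha)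
  exact hπ.trans ((pow_dvd_pow π hle).trans (pow_dvd_pow_of_dvd hdvd _))

theorem associated_sub_one_pow_prime {B : Type*} [CommRing B] [IsDomain B] {p : ℕ}
    [hp : Fact p.Prime] {ζ : B} (hζ : IsPrimitiveRoot ζ p) :
    Associated ((ζ - 1) ^ (p - 1)) (p : B) := by
  rw [← eval_one_cyclotomic_prime (R := B) (p := p),
    cyclotomic_eq_prod_X_sub_primitiveRoots hζ, eval_prod]
  simp only [eval_sub, eval_X, eval_C]
  rw [← Nat.totient_prime hp.out, ← hζ.card_primitiveRoots, ← Finset.prod_const]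
  refine Associated.prod _ _ _ fun η hη ↦ ?_
  obtain ⟨i, -, hi, rfl⟩ := hζ.isPrimitiveRoot_iff.mp (isPrimitiveRoot_of_mem_primitiveRoots hη)
  rw [← neg_sub (ζ ^ i) 1]
  exact (hζ.associated_sub_one_pow_sub_one_of_coprime hi).neg_right

section PiAdic

variable {A B : Type*} [CommRing A] [CommRing B] [IsDomain B] [Algebra A B] {π q : B} {n : ℕ}

theorem dvd_algebraMap_coeff_of_pow_dvd_aeval (hπ : π ≠ 0) (hq : π ^ n ∣ q)
    (hA : ∀ a : A, π ∣ algebraMap A B a → q ∣ algebraMap A B a) {f : A[X]}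
    (hf : f.natDegree ≤ n) (hf₀ : f.coeff 0 = 0) (hdvd : π ^ (n + 1) ∣ aeval π f) (j : ℕ) :
    q ∣ algebraMap A B (f.coeff j) := by
  induction j using Nat.strong_induction_on with
  | _ j ih =>
    rcases lt_or_ge n j with hnj | hjn
    · simp [coeff_eq_zero_of_natDegree_lt (hf.trans_lt hnj)]
    have hother : ∀ k ∈ (Finset.range (n + 1)).erase j,
        π ^ (j + 1) ∣ algebraMap A B (f.coeff k) * π ^ k := fun k hk => by
      rcases (Finset.ne_of_mem_erase hk).lt_or_gt with hkj | hjk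
      · rcases k.eq_zero_or_pos with rfl | hk₀
        · simp [hf₀]
        · refine (pow_dvd_pow π (show j + 1 ≤ n + k by lia)).trans ?_
          rw [pow_add]
          exact mul_dvd_mul_right (hq.trans (ih k hkj)) _
      · exact (pow_dvd_pow π hjk).mul_left _
    have hterm : π * π ^ j ∣ algebraMap A B (f.coeff j) * π ^ j := by
      have hsum := (pow_dvd_pow π (Nat.succ_le_succ hjn)).trans hdvd
      simp only [aeval_eq_sum_range' (Nat.lt_succ_of_le hf), Algebra.smul_def] at hsum
      rwa [← Finset.add_sum_erase _ _ (Finset.mem_range_succ_iff.mpr hjn),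
        dvd_add_left (Finset.dvd_sum hother), pow_succ'] at hsum
    exact hA _ ((mul_dvd_mul_iff_right (pow_ne_zero j hπ)).mp hterm)

theorem dvd_algebraMap_coeff_of_pow_dvd_aeval_one_add (hπ : π ≠ 0) (hq : π ^ n ∣ q)
    (hA : ∀ a : A, π ∣ algebraMap A B a → q ∣ algebraMap A B a) {f : A[X]}
    (hf : f.natDegree ≤ n) (hf₁ : f.eval 1 = 0) (hdvd : π ^ (n + 1) ∣ aeval (π + 1) f) (j : ℕ) :
    q ∣ algebraMap A B (f.coeff j) := by
  have htaylor := dvd_algebraMap_coeff_of_pow_dvd_aeval (f := taylor 1 f) hπ hq hA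
    (by rwa [natDegree_taylor]) (by rwa [taylor_coeff_zero])
    (by simpa [taylor_apply, aeval_comp] using hdvd)
  let φ : A →+* B ⧸ Ideal.span {q} := (Ideal.Quotient.mk _).comp (algebraMap A B)
  have hφ (a : A) : φ a = 0 ↔ q ∣ algebraMap A B a :=
    Ideal.Quotient.eq_zero_iff_mem.trans Ideal.mem_span_singleton
  have hzero : taylor (φ 1) (f.map φ) = 0 := by
    rw [← map_taylor]
    ext j
    rw [coeff_map, coeff_zero, hφ]
    exact htaylor j
  rw [← hφ, ← coeff_map, (taylor_eq_zero _ _).mp hzero, coeff_zero]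

end PiAdic

theorem natCast_dvd_algebraMap_of_sub_one_pow_dvd_sum {A B : Type*} [CommRing A] [CommRing B]
    [IsDomain B] [Algebra A B] {p : ℕ} [hp : Fact p.Prime] {ζ : B} (hζ : IsPrimitiveRoot ζ p)
    (hA : ∀ a : A, ζ - 1 ∣ algebraMap A B a → (p : B) ∣ algebraMap A B a) {c : ℕ → A}
    (hsum : ∑ i ∈ Finset.range p, c i = 0)
    (hdvd : (ζ - 1) ^ p ∣ ∑ i ∈ Finset.range p, ζ ^ i * algebraMap A B (c i))
    {i : ℕ} (hi : i < p) : (p : B) ∣ algebraMap A B (c i) := by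
  let f : A[X] := ∑ i ∈ Finset.range p, monomial i (c i)
  have hcoeff : f.coeff i = c i := by
    simp [f, finsetSum_coeff, coeff_monomial, hi]
  have hdeg : f.natDegree ≤ p - 1 := natDegree_sum_le_of_forall_le _ _ fun i hi =>
    (natDegree_monomial_le _).trans (Nat.le_pred_of_lt (Finset.mem_range.mp hi))
  rw [← hcoeff]
  refine dvd_algebraMap_coeff_of_pow_dvd_aeval_one_add
    (sub_ne_zero.mpr (hζ.ne_one hp.out.one_lt)) (associated_sub_one_pow_prime hζ).dvd hA hdeg
    ?_ ?_ i
  · simpa [f, eval_finsetSum] using hsum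
  · simpa [f, Nat.sub_add_cancel hp.out.one_le, aeval_monomial, mul_comm] using hdvd

theorem map_zmod_eq_of_map_quotient_eq {B : Type*} [CommRing B] {p : ℕ} [hp : Fact p.Prime]
    (hu : ¬ IsUnit (p : B)) {P Q : ℤ[X]}
    (h : P.map (Int.castRingHom (B ⧸ Ideal.span {(p : B)})) =
      Q.map (Int.castRingHom (B ⧸ Ideal.span {(p : B)}))) :
    P.map (Int.castRingHom (ZMod p)) = Q.map (Int.castRingHom (ZMod p)) := by
  have : CharP (B ⧸ Ideal.span {(p : B)}) p := CharP.quotient B p hu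
  have : Nontrivial (B ⧸ Ideal.span {(p : B)}) := CharP.nontrivial_of_char_ne_one hp.out.ne_one
  apply Polynomial.map_injective (ZMod.castHom dvd_rfl (B ⧸ Ideal.span {(p : B)}))
    (RingHom.injective _)
  rwa [Polynomial.map_map, Polynomial.map_map,
    RingHom.ext_int (RingHom.comp _ _) (Int.castRingHom (B ⧸ Ideal.span {(p : B)}))]

section GaussPeriod

variable {ℓ : ℕ} {M R S : Type*}

open Classical in
/-- The Gaussian period `∑ ξ ^ x` over the fibre of the character `ψ` above `ε`; for `ψ` of order
`p` and `ξ` a primitive `ℓ`-th root of unity, the periods with `ε` in `μ_p` are the `p` classical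
periods of degree `p`. -/
noncomputable def gaussPeriod [NeZero ℓ] [MulOneClass M] [CommSemiring R] (ψ : (ZMod ℓ)ˣ →* M)
    (ξ : R) (ε : M) : R :=
  ∑ x : (ZMod ℓ)ˣ with ψ x = ε, ξ ^ (x : ZMod ℓ).val

theorem map_gaussPeriod [NeZero ℓ] [MulOneClass M] [CommSemiring R] [CommSemiring S]
    {T : Type*} [FunLike T R S] [RingHomClass T R S] (f : T) (ψ : (ZMod ℓ)ˣ →* M) (ξ : R) (ε : M) :
    f (gaussPeriod ψ ξ ε) = gaussPeriod ψ (f ξ) ε := by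
  simp [gaussPeriod]

theorem gaussPeriod_mem_adjoin [NeZero ℓ] [MulOneClass M] [CommRing R] (ψ : (ZMod ℓ)ˣ →* M)
    {ξ : R} {X : Set R} (hξ : ξ ∈ X) (ε : M) : gaussPeriod ψ ξ ε ∈ Algebra.adjoin ℤ X :=
  sum_mem fun _ _ => pow_mem (Algebra.subset_adjoin hξ) _

theorem gaussPeriod_pow_val [NeZero ℓ] [CommMonoid M] [CommSemiring R] (ψ : (ZMod ℓ)ˣ →* M)
    {ξ : R} (hξ : ξ ^ ℓ = 1) (u : (ZMod ℓ)ˣ) (ε : M) :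
    gaussPeriod ψ (ξ ^ (u : ZMod ℓ).val) ε = gaussPeriod ψ ξ (ε * ψ u) := by
  refine Finset.sum_equiv (Equiv.mulRight u) (fun x => ?_) fun x _ => ?_
  · simp [((Group.isUnit u).map ψ).mul_left_inj]
  · rw [← pow_mul, Equiv.coe_mulRight, Units.val_mul, ZMod.val_mul, ← pow_eq_pow_mod _ hξ, mul_comm]

theorem sum_pow_val_units [hℓ : Fact ℓ.Prime] [CommRing R] [IsDomain R] {ξ : R}
    (hξ : IsPrimitiveRoot ξ ℓ) : ∑ x : (ZMod ℓ)ˣ, ξ ^ (x : ZMod ℓ).val = -1 := by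
  have hχ : AddChar.zmodChar ℓ hξ.pow_eq_one ≠ 1 := fun h => hξ.ne_one hℓ.out.one_lt <| by
    simpa [AddChar.zmodChar_apply, ZMod.val_one] using DFunLike.congr_fun h 1
  rw [← gaussSum_one_left hχ, gaussSum]
  refine Fintype.sum_of_injective Units.val Units.val_injective _ _ (fun a ha => ?_) fun x => ?_
  · rw [MulChar.map_nonunit _ ha, zero_mul]
  · rw [MulChar.one_apply_coe, one_mul, AddChar.zmodChar_apply]

section RootsOfUnity

variable [CommRing M] [IsDomain M] {p : ℕ}

theorem sum_nthRootsFinset_one_eq_sum_range [NeZero p] [AddCommMonoid R] {ζ : M}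
    (hζ : IsPrimitiveRoot ζ p) (f : M → R) :
    ∑ ε ∈ nthRootsFinset p (1 : M), f ε = ∑ i ∈ Finset.range p, f (ζ ^ i) := by
  have hmem (ε : M) : ε ∈ nthRootsFinset p 1 ↔ ε ^ p = 1 := mem_nthRootsFinset (NeZero.pos p) 1
  refine (Finset.sum_nbij (ζ ^ ·) (fun i _ => ?_) ?_ (fun ε hε => ?_) fun _ _ => rfl).symm
  · rw [hmem, pow_right_comm, hζ.pow_eq_one, one_pow]
  · simpa using hζ.injOn_pow
  · obtain ⟨i, hi, rfl⟩ := hζ.eq_pow_of_pow_eq_one ((hmem ε).mp hε)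
    exact ⟨i, Finset.mem_coe.mpr (Finset.mem_range.mpr hi), rfl⟩

open Classical in
theorem sum_fiber_nthRootsFinset [NeZero ℓ] [NeZero p] [AddCommMonoid R] {ψ : (ZMod ℓ)ˣ →* M}
    (hψ : ψ ^ p = 1) (f : (ZMod ℓ)ˣ → R) :
    ∑ ε ∈ nthRootsFinset p (1 : M), ∑ x : (ZMod ℓ)ˣ with ψ x = ε, f x = ∑ x, f x :=
  Finset.sum_fiberwise_of_maps_to (fun x _ =>
    (mem_nthRootsFinset (NeZero.pos p) 1).mpr (DFunLike.congr_fun hψ x)) f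

theorem sum_gaussPeriod [Fact ℓ.Prime] [NeZero p] [CommRing R] [IsDomain R] {ψ : (ZMod ℓ)ˣ →* M}
    (hψ : ψ ^ p = 1) {ξ : R} (hξ : IsPrimitiveRoot ξ ℓ) :
    ∑ ε ∈ nthRootsFinset p (1 : M), gaussPeriod ψ ξ ε = -1 :=
  (sum_fiber_nthRootsFinset hψ _).trans (sum_pow_val_units hξ)

end RootsOfUnity

theorem tau_eq_neg_sum_gaussPeriod [Fact ℓ.Prime] {Ω : Type*} [Field Ω] {p : ℕ} [NeZero p]
    {ψ : (ZMod ℓ)ˣ →* Ω} (hψ : ψ ^ p = 1) (ξ : Ω) :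
    tau ψ ξ = -∑ ε ∈ nthRootsFinset p (1 : Ω), ε * gaussPeriod ψ ξ ε := by
  classical
  rw [tau, ← sum_fiber_nthRootsFinset hψ]
  refine congrArg Neg.neg (Finset.sum_congr rfl fun ε _ => ?_)
  rw [gaussPeriod, Finset.mul_sum]
  refine Finset.sum_congr (by congr) fun x hx => ?_
  rw [(Finset.mem_filter.mp hx).2]

/-- The period polynomial of degree `p`, whose roots are the Gaussian periods of `ψ` at `ξ` attached
to the `p`-th roots of unity `ε`. -/
noncomputable def periodPoly [NeZero ℓ] [CommRing M] [IsDomain M] [CommRing R] (p : ℕ)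
    (ψ : (ZMod ℓ)ˣ →* M) (ξ : R) : R[X] :=
  ∏ ε ∈ nthRootsFinset p (1 : M), (X - C (gaussPeriod ψ ξ ε))

theorem map_periodPoly [NeZero ℓ] [CommRing M] [IsDomain M] [CommRing R] [CommRing S] (f : R →+* S)
    (p : ℕ) (ψ : (ZMod ℓ)ˣ →* M) (ξ : R) : (periodPoly p ψ ξ).map f = periodPoly p ψ (f ξ) := by
  simp [periodPoly, Polynomial.map_prod, ← map_gaussPeriod f]

theorem periodPoly_pow_val [NeZero ℓ] [CommRing M] [IsDomain M] [CommRing R] {p : ℕ} [NeZero p]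
    {ψ : (ZMod ℓ)ˣ →* M} (hψ : ψ ^ p = 1) {ξ : R} (hξ : ξ ^ ℓ = 1) (u : (ZMod ℓ)ˣ) :
    periodPoly p ψ (ξ ^ (u : ZMod ℓ).val) = periodPoly p ψ ξ := by
  have hψu : ψ u ^ p = 1 := DFunLike.congr_fun hψ u
  refine Finset.prod_equiv (Units.mulRight (ψ.toHomUnits u)) (fun ε => ?_) fun ε _ => ?_
  · simp [mem_nthRootsFinset (NeZero.pos p), mul_pow, hψu]
  · rw [gaussPeriod_pow_val ψ hξ]
    rfl

end GaussPeriod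

section CharacterOrder

variable {G M : Type*}

theorem orderOf_monoidHom_eq_orderOf_apply [Group G] [CommMonoid M] {g : G}
    (hg : ∀ x, x ∈ Subgroup.zpowers g) (ψ : G →* M) : orderOf ψ = orderOf (ψ g) := by
  refine orderOf_eq_orderOf_iff.mpr fun n => ⟨fun h => DFunLike.congr_fun h g, fun h => ?_⟩
  ext x
  obtain ⟨k, rfl⟩ := hg x
  have hψg : (ψ ^ n).toHomUnits g = 1 := Units.ext h
  have hψk : (ψ ^ n).toHomUnits (g ^ k) = 1 := by rw [map_zpow, hψg, one_zpow]
  exact congrArg Units.val hψk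

theorem powMonoidHom_index_range_eq [CommGroup G] [IsCyclic G] [Finite G] (H : Subgroup G) :
    (powMonoidHom H.index : G →* G).range = H := by
  have hle : (powMonoidHom H.index : G →* G).range ≤ H := by
    rintro _ ⟨x, rfl⟩
    exact H.pow_index_mem x
  have hindex : (powMonoidHom H.index : G →* G).range.index = H.index := by
    rw [IsCyclic.index_powMonoidHom_range, Nat.gcd_eq_right H.index_dvd_card]
  have hrel := Subgroup.relIndex_mul_index hle
  rw [hindex, Nat.mul_eq_right Subgroup.index_ne_zero_of_finite, Subgroup.relIndex_eq_one] at hrel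
  exact hle.antisymm hrel

theorem coprime_of_orderOf_eq [CommMonoid M] {p ℓ : ℕ} [hℓ : Fact ℓ.Prime] {ψ : (ZMod ℓ)ˣ →* M}
    (hψ : orderOf ψ = p) : p.Coprime ℓ := by
  have hdvd : p ∣ ℓ - 1 := by
    rw [← hψ]
    refine orderOf_dvd_of_pow_eq_one (MonoidHom.ext fun x => ?_)
    rw [MonoidHom.pow_apply, ← map_pow, ZMod.units_pow_card_sub_one_eq_one, map_one,
      MonoidHom.one_apply]
  refine Nat.Coprime.of_dvd_left hdvd ?_
  exact (Nat.coprime_self_sub_left hℓ.out.one_le).mpr (Nat.coprime_one_left ℓ)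

theorem exists_isPrimitiveRoot_apply [Group G] [CommMonoid M] {p : ℕ} [hp : Fact p.Prime]
    {ψ : G →* M} (hψ : orderOf ψ = p) : ∃ x, IsPrimitiveRoot (ψ x) p := by
  obtain ⟨x, hx⟩ : ∃ x, ψ x ≠ 1 := by
    by_contra! h
    rw [show ψ = 1 from MonoidHom.ext h, orderOf_one] at hψ
    exact hp.out.ne_one hψ.symm
  have hpow : ψ x ^ p = 1 := DFunLike.congr_fun (hψ ▸ pow_orderOf_eq_one ψ) x
  exact ⟨x, IsPrimitiveRoot.iff_orderOf.mpr (orderOf_eq_prime hpow hx)⟩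

variable [CommRing M] [IsDomain M] {p : ℕ} [Fact p.Prime]

theorem exists_apply_eq_of_pow_eq_one [Group G] {ψ : G →* M} (hψ : orderOf ψ = p) {ε : M}
    (hε : ε ^ p = 1) : ∃ x, ψ x = ε := by
  obtain ⟨x, hx⟩ := exists_isPrimitiveRoot_apply hψ
  obtain ⟨i, -, hi⟩ := hx.eq_pow_of_pow_eq_one hε
  exact ⟨x ^ i, by rw [map_pow, hi]⟩

theorem index_ker_eq_of_orderOf_eq_prime [Group G] {ψ : G →* M} (hψ : orderOf ψ = p) :
    ψ.ker.index = p := by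
  have hker : ψ.toHomUnits.ker = ψ.ker := by
    ext x
    simp [MonoidHom.mem_ker]
  have hrange : ψ.toHomUnits.range = rootsOfUnity p M := by
    ext u
    rw [mem_rootsOfUnity']
    constructor
    · rintro ⟨x, rfl⟩
      exact DFunLike.congr_fun (hψ ▸ pow_orderOf_eq_one ψ) x
    · intro hu
      obtain ⟨x, hx⟩ := exists_apply_eq_of_pow_eq_one hψ hu
      exact ⟨x, Units.ext hx⟩
  obtain ⟨x, hx⟩ := exists_isPrimitiveRoot_apply hψ
  rw [← hker, Subgroup.index_ker, hrange, hx.card_rootsOfUnity]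

theorem eq_ker_of_index_eq_prime [CommGroup G] [IsCyclic G] [Finite G] {ψ : G →* M}
    (hψ : orderOf ψ = p) {H : Subgroup G} (hH : H.index = p) : H = ψ.ker := by
  rw [← powMonoidHom_index_range_eq H, ← powMonoidHom_index_range_eq ψ.ker, hH,
    index_ker_eq_of_orderOf_eq_prime hψ]

end CharacterOrder

section GaloisAction

open IsCyclotomicExtension.Rat

variable {ℓ p : ℕ} [Fact ℓ.Prime] {L M : Type*} [Field L] [NumberField L]
  [IsCyclotomicExtension {ℓ} ℚ L] [CommRing M] {η : L}

theorem galEquivZMod_apply_gaussPeriod (σ : Gal(L/ℚ)) (ψ : (ZMod ℓ)ˣ →* M) (hη : η ^ ℓ = 1)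
    (ε : M) : σ (gaussPeriod ψ η ε) = gaussPeriod ψ η (ε * ψ (galEquivZMod ℓ L σ)) := by
  rw [map_gaussPeriod, galEquivZMod_apply_of_pow_eq ℓ L σ hη, gaussPeriod_pow_val ψ hη]

variable [IsDomain M] [hp : Fact p.Prime] {ψ : (ZMod ℓ)ˣ →* M} {F : IntermediateField ℚ L}

theorem mem_fixingSubgroup_iff_apply_eq_one (hψ : orderOf ψ = p) (hF : Module.finrank ℚ F = p)
    {σ : Gal(L/ℚ)} : σ ∈ F.fixingSubgroup ↔ ψ (galEquivZMod ℓ L σ) = 1 := by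
  have : IsGalois ℚ L := IsCyclotomicExtension.isGalois {ℓ} ℚ L
  generalize galEquivZMod ℓ L = e
  have hindex : (F.fixingSubgroup.map e.toMonoidHom).index = p := by
    rw [← hF, finrank_eq_fixingSubgroup_index]
    exact Subgroup.index_map_equiv _ e
  rw [← MonoidHom.mem_ker, ← eq_ker_of_index_eq_prime hψ hindex]
  exact (Subgroup.mem_map_iff_mem e.injective).symm

theorem gaussPeriod_mem_of_finrank_eq (hψ : orderOf ψ = p) (hF : Module.finrank ℚ F = p)
    (hη : η ^ ℓ = 1) (ε : M) : gaussPeriod ψ η ε ∈ F := by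
  have : IsGalois ℚ L := IsCyclotomicExtension.isGalois {ℓ} ℚ L
  rw [← IsGalois.fixedField_fixingSubgroup F, mem_fixedField_iff]
  intro σ hσ
  rw [galEquivZMod_apply_gaussPeriod σ ψ hη,
    (mem_fixingSubgroup_iff_apply_eq_one hψ hF).mp hσ, mul_one]

theorem algebraMap_trace_eq_gaussPeriod (hψ : orderOf ψ = p) (hF : Module.finrank ℚ F = p)
    (hη : η ^ ℓ = 1) : algebraMap F L (Algebra.trace F L η) = gaussPeriod ψ η 1 := by
  have : IsGalois ℚ L := IsCyclotomicExtension.isGalois {ℓ} ℚ L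
  have hmem (σ : Gal(L/ℚ)) := mem_fixingSubgroup_iff_apply_eq_one (σ := σ) hψ hF
  rw [trace_eq_sum_automorphisms, gaussPeriod]
  refine Finset.sum_bij (fun σ _ => galEquivZMod ℓ L (F.fixingSubgroupEquiv.symm σ))
    (fun σ _ => ?_) (fun σ _ τ _ h => ?_) (fun x hx => ?_) fun σ _ => ?_
  · simpa using (hmem _).mp (F.fixingSubgroupEquiv.symm σ).2
  · exact F.fixingSubgroupEquiv.symm.injective (Subtype.ext ((galEquivZMod ℓ L).injective h))
  · have hx' : (galEquivZMod ℓ L).symm x ∈ F.fixingSubgroup := by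
      rw [hmem, MulEquiv.apply_symm_apply]
      simpa using hx
    refine ⟨F.fixingSubgroupEquiv ⟨_, hx'⟩, Finset.mem_univ _, ?_⟩
    rw [MulEquiv.symm_apply_apply, MulEquiv.apply_symm_apply]
  · exact galEquivZMod_apply_of_pow_eq ℓ L (F.fixingSubgroupEquiv.symm σ).1 hη

theorem restrictNormalHom_eq_iff_apply_eq [Normal ℚ F] (hψ : orderOf ψ = p)
    (hF : Module.finrank ℚ F = p) {σ τ : Gal(L/ℚ)} :
    AlgEquiv.restrictNormalHom F σ = AlgEquiv.restrictNormalHom F τ ↔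
      ψ (galEquivZMod ℓ L σ) = ψ (galEquivZMod ℓ L τ) := by
  have hmem : AlgEquiv.restrictNormalHom F σ = AlgEquiv.restrictNormalHom F τ ↔
      τ⁻¹ * σ ∈ F.fixingSubgroup := by
    rw [AlgEquiv.ext_iff, IntermediateField.mem_fixingSubgroup_iff, Subtype.forall]
    refine forall₂_congr fun x hx => ?_
    rw [← (algebraMap F L).injective.eq_iff]
    exact (iff_of_eq (congrArg₂ Eq (AlgEquiv.restrictNormal_commutes σ F ⟨x, hx⟩)
      (AlgEquiv.restrictNormal_commutes τ F ⟨x, hx⟩))).trans (AlgEquiv.symm_apply_eq τ).symm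
  rw [hmem, mem_fixingSubgroup_iff_apply_eq_one hψ hF, ← MonoidHom.mem_ker]
  exact (MonoidHom.eq_iff (ψ.comp (galEquivZMod ℓ L).toMonoidHom)).symm

theorem prod_X_sub_C_galois_trace_eq_periodPoly [Normal ℚ F] (hψ : orderOf ψ = p)
    (hF : Module.finrank ℚ F = p) (hη : η ^ ℓ = 1) :
    ∏ τ : Gal(F/ℚ), (X - C (algebraMap F L (τ (Algebra.trace F L η)))) = periodPoly p ψ η := by
  have hsurj : Function.Surjective (AlgEquiv.restrictNormalHom F : Gal(L/ℚ) →* Gal(F/ℚ)) := by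
    have : IsGalois ℚ L := IsCyclotomicExtension.isGalois {ℓ} ℚ L
    exact AlgEquiv.restrictNormalHom_surjective L
  choose lift hlift using hsurj
  refine Finset.prod_nbij (fun τ => ψ (galEquivZMod ℓ L (lift τ))) (fun τ _ => ?_)
    (fun τ _ τ' _ h => ?_) (fun ε hε => ?_) fun τ _ => ?_
  · rw [mem_nthRootsFinset hp.out.pos]
    exact DFunLike.congr_fun (hψ ▸ pow_orderOf_eq_one ψ) _
  · rw [← hlift τ, ← hlift τ']
    exact (restrictNormalHom_eq_iff_apply_eq hψ hF).mpr h
  · obtain ⟨x, rfl⟩ := exists_apply_eq_of_pow_eq_one hψ ((mem_nthRootsFinset hp.out.pos 1).mp hε)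
    refine ⟨AlgEquiv.restrictNormalHom F ((galEquivZMod ℓ L).symm x), Finset.mem_univ _, ?_⟩
    exact ((restrictNormalHom_eq_iff_apply_eq hψ hF).mp (hlift _)).trans
      (by rw [MulEquiv.apply_symm_apply])
  · congr 2
    conv_lhs => rw [← hlift τ]
    exact (AlgEquiv.restrictNormal_commutes _ F _).trans <| by
      rw [algebraMap_trace_eq_gaussPeriod hψ hF hη, galEquivZMod_apply_gaussPeriod _ ψ hη, one_mul]

end GaloisAction

section AdjoinRootOfUnity

variable {K Ω : Type*} [Field K] [Field Ω]

theorem isPrimitiveRoot_adjoinSimple_gen [Algebra K Ω] {n : ℕ} {ξ : Ω} (hξ : IsPrimitiveRoot ξ n) :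
    IsPrimitiveRoot (AdjoinSimple.gen K ξ) n :=
  .of_map_of_injective (f := algebraMap K⟮ξ⟯ Ω) (by simpa using hξ) (algebraMap K⟮ξ⟯ Ω).injective

theorem isCyclotomicExtension_adjoin_simple [Algebra K Ω] {n : ℕ} [NeZero n] {ξ : Ω}
    (hξ : IsPrimitiveRoot ξ n) : IsCyclotomicExtension {n} K K⟮ξ⟯ := by
  change IsCyclotomicExtension {n} K K⟮ξ⟯.toSubalgebra
  rw [adjoin_simple_toSubalgebra_of_isAlgebraic
    ((hξ.isIntegral (NeZero.pos n)).tower_top (A := K)).isAlgebraic]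
  exact hξ.adjoin_isCyclotomicExtension K

variable [CharZero Ω] {ℓ p : ℕ} [hℓ : Fact ℓ.Prime] [Fact p.Prime] {ξ : Ω}
  {F : IntermediateField ℚ ℚ⟮ξ⟯} {M : Type*} [CommRing M] [IsDomain M] {ψ : (ZMod ℓ)ˣ →* M}

theorem map_intPoly_eq_periodPoly_self (hξ : IsPrimitiveRoot ξ ℓ) (hF : Module.finrank ℚ F = p)
    (hψ : orderOf ψ = p) : (intPoly ξ F).map (Int.castRingHom Ω) = periodPoly p ψ ξ := by
  have : IsCyclotomicExtension {ℓ} ℚ ℚ⟮ξ⟯ := isCyclotomicExtension_adjoin_simple hξ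
  have : NumberField ℚ⟮ξ⟯ := IsCyclotomicExtension.numberField {ℓ} ℚ _
  have : IsAbelianGalois ℚ ℚ⟮ξ⟯ := IsCyclotomicExtension.isAbelianGalois {ℓ} ℚ _
  have : IsAbelianGalois ℚ F := IsAbelianGalois.tower_bot ℚ F ℚ⟮ξ⟯
  have hgen : AdjoinSimple.gen ℚ ξ ^ ℓ = 1 := (isPrimitiveRoot_adjoinSimple_gen hξ).pow_eq_one
  have hconj : (conjPoly ξ F).map (algebraMap F ℚ⟮ξ⟯) = periodPoly p ψ (AdjoinSimple.gen ℚ ξ) := by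
    rw [← prod_X_sub_C_galois_trace_eq_periodPoly hψ hF hgen, conjPoly,
      finprod_eq_prod_of_fintype, Polynomial.map_prod]
    simp only [Polynomial.map_sub, map_X, map_C, relTrace]
  rw [← map_intPoly hℓ.out.ne_zero hξ, Polynomial.map_map] at hconj
  have hmap := congrArg (Polynomial.map (algebraMap ℚ⟮ξ⟯ Ω)) hconj
  rwa [Polynomial.map_map, RingHom.ext_int (RingHom.comp _ _) (Int.castRingHom Ω), map_periodPoly,
    AdjoinSimple.algebraMap_gen] at hmap

theorem map_intPoly_eq_periodPoly (hξ : IsPrimitiveRoot ξ ℓ) (hF : Module.finrank ℚ F = p)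
    (hψ : orderOf ψ = p) {ξ' : Ω} (hξ' : IsPrimitiveRoot ξ' ℓ) :
    (intPoly ξ F).map (Int.castRingHom Ω) = periodPoly p ψ ξ' := by
  obtain ⟨i, hi, hcop, rfl⟩ := hξ.isPrimitiveRoot_iff.mp hξ'
  have hu : (ZMod.unitOfCoprime i hcop : ZMod ℓ).val = i := by
    rw [ZMod.coe_unitOfCoprime, ZMod.val_cast_of_lt hi]
  rw [← hu, periodPoly_pow_val (hψ ▸ pow_orderOf_eq_one ψ) hξ.pow_eq_one,
    map_intPoly_eq_periodPoly_self hξ hF hψ]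

theorem gaussPeriod_mem_lift (hξ : IsPrimitiveRoot ξ ℓ) (hF : Module.finrank ℚ F = p)
    (hψ : orderOf ψ = p) (ε : M) : gaussPeriod ψ ξ ε ∈ IntermediateField.lift F := by
  have : IsCyclotomicExtension {ℓ} ℚ ℚ⟮ξ⟯ := isCyclotomicExtension_adjoin_simple hξ
  have : NumberField ℚ⟮ξ⟯ := IsCyclotomicExtension.numberField {ℓ} ℚ _
  have hgen : AdjoinSimple.gen ℚ ξ ^ ℓ = 1 := (isPrimitiveRoot_adjoinSimple_gen hξ).pow_eq_one
  refine ⟨_, gaussPeriod_mem_of_finrank_eq hψ hF hgen ε, ?_⟩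
  rw [AlgHom.coe_toRingHom, map_gaussPeriod]
  exact congrArg (gaussPeriod ψ · ε) (AdjoinSimple.algebraMap_gen ℚ ξ)

end AdjoinRootOfUnity

section GaussSum

variable {ℓ p : ℕ} [hℓ : Fact ℓ.Prime] [hp : Fact p.Prime] {Ω : Type*} [Field Ω] {ξ : Ω}
  {ψ : (ZMod ℓ)ˣ →* Ω}

theorem isIntegral_tau (ψ : (ZMod ℓ)ˣ →* Ω) (hξ : ξ ^ ℓ = 1) : IsIntegral ℤ (tau ψ ξ) := by
  have hξ_int : IsIntegral ℤ ξ := .of_pow hℓ.out.pos (hξ ▸ isIntegral_one)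
  refine (IsIntegral.sum _ fun x _ => .mul (.of_pow (orderOf_pos x) ?_) (hξ_int.pow _)).neg
  rw [← map_pow, pow_orderOf_eq_one, map_one]
  exact isIntegral_one

theorem tau_mem [CharZero Ω] {ζ : Ω} (hζ : IsPrimitiveRoot ζ p) (hξ : IsPrimitiveRoot ξ ℓ)
    {F : IntermediateField ℚ ℚ⟮ξ⟯} (hF : Module.finrank ℚ F = p) (hψ : orderOf ψ = p)
    {E : IntermediateField ℚ Ω} (hζE : ζ ∈ E) (hFE : IntermediateField.lift F ≤ E) :
    tau ψ ξ ∈ E := by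
  rw [tau_eq_neg_sum_gaussPeriod (hψ ▸ pow_orderOf_eq_one ψ),
    sum_nthRootsFinset_one_eq_sum_range hζ fun ε => ε * gaussPeriod ψ ξ ε]
  exact neg_mem (sum_mem fun i _ =>
    mul_mem (pow_mem hζE i) (hFE (gaussPeriod_mem_lift hξ hF hψ _)))

end GaussSum

section Conjugates

variable {Ω : Type*} [Field Ω]

theorem isIntegral_and_splits_minpoly_of_isOfFinOrder (K : Type*) [Field K] [Algebra K Ω] {η : Ω}
    (hη : IsOfFinOrder η) : IsIntegral K η ∧ ((minpoly K η).map (algebraMap K Ω)).Splits := by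
  have hpos : 0 < orderOf η := hη.orderOf_pos
  have hroot : aeval η (X ^ orderOf η - 1 : K[X]) = 0 := by simp [pow_orderOf_eq_one]
  have hmonic : (X ^ orderOf η - 1 : K[X]).Monic := monic_X_pow_sub_C 1 hpos.ne'
  refine ⟨⟨_, hmonic, hroot⟩, ?_⟩
  refine Splits.of_dvd (g := (X ^ orderOf η - 1 : K[X]).map (algebraMap K Ω)) ?_
    (hmonic.map _).ne_zero (Polynomial.map_dvd _ (minpoly.dvd K η hroot))
  simpa using X_pow_sub_one_splits (IsPrimitiveRoot.orderOf η)

variable {ℓ : ℕ} [hℓ : Fact ℓ.Prime]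

theorem orderOf_monoidHom_comp_of_injective {G M N : Type*} [Group G] [CommMonoid M] [CommMonoid N]
    {f : M →* N} (hf : Function.Injective f) (ψ : G →* M) : orderOf (f.comp ψ) = orderOf ψ :=
  orderOf_injective (MonoidHom.compHom f) (fun _ _ => (MonoidHom.cancel_left hf).mp) ψ

theorem map_tau {L : Type*} [Field L] (f : L →+* Ω) (ψ : (ZMod ℓ)ˣ →* L) (ξ : L) :
    f (tau ψ ξ) = tau ((f : L →* Ω).comp ψ) (f ξ) := by
  simp [tau]

theorem exists_eq_tau_of_aeval_minpoly_eq_zero {K : Type*} [Field K] [Algebra K Ω]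
    (ψ : (ZMod ℓ)ˣ →* Ω) {ξ : Ω} (hξ : IsPrimitiveRoot ξ ℓ) {y : Ω}
    (hy : aeval y (minpoly K (tau ψ ξ)) = 0) :
    ∃ (ψ' : (ZMod ℓ)ˣ →* Ω) (ξ' : Ω),
      orderOf ψ' = orderOf ψ ∧ IsPrimitiveRoot ξ' ℓ ∧ y = tau ψ' ξ' := by
  let L : IntermediateField K Ω := IntermediateField.adjoin K (insert ξ (Set.range ψ))
  have hψL (x : (ZMod ℓ)ˣ) : ψ x ∈ L :=
    subset_adjoin K _ (Set.mem_insert_of_mem ξ (Set.mem_range_self x))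
  let ψL : (ZMod ℓ)ˣ →* L := ψ.codRestrict L hψL
  let ξL : L := ⟨ξ, subset_adjoin K _ (Set.mem_insert ξ _)⟩
  have hτ : ((tau ψL ξL : L) : Ω) = tau ψ ξ := map_tau (algebraMap L Ω) ψL ξL
  have hsplits : ∀ s ∈ insert ξ (Set.range ψ),
      IsIntegral K s ∧ ((minpoly K s).map (algebraMap K Ω)).Splits := by
    rintro _ (rfl | ⟨x, rfl⟩)
    · exact isIntegral_and_splits_minpoly_of_isOfFinOrder K (hξ.isOfFinOrder hℓ.out.ne_zero)
    · exact isIntegral_and_splits_minpoly_of_isOfFinOrder K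
        (ψ.isOfFinOrder (isOfFinOrder_of_finite x))
  obtain ⟨φ, hφ⟩ := exists_algHom_adjoin_of_splits_of_aeval hsplits (hτ ▸ (tau ψL ξL).2) hy
  have hφτ : φ (tau ψL ξL) = y := by rw [← hφ]; exact congrArg φ (Subtype.ext hτ)
  have hξL : IsPrimitiveRoot ξL ℓ :=
    .of_map_of_injective (f := algebraMap L Ω) hξ (algebraMap L Ω).injective
  refine ⟨(φ.toRingHom : L →* Ω).comp ψL, φ ξL, ?_, hξL.map_of_injective φ.injective, ?_⟩
  · calc orderOf ((φ.toRingHom : L →* Ω).comp ψL)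
        = orderOf ψL := orderOf_monoidHom_comp_of_injective φ.injective ψL
      _ = orderOf ψ :=
        (orderOf_monoidHom_comp_of_injective (f := (algebraMap L Ω : L →* Ω))
          (algebraMap L Ω).injective ψL).symm
  · rw [← hφτ]
    exact map_tau φ.toRingHom ψL ξL

end Conjugates

theorem map_periodPoly_quotient_eq_of_forall_dvd {B M : Type*} [CommRing B] [CommRing M]
    [IsDomain M] {q : B} {n ℓ₁ ℓ₂ : ℕ} [NeZero n] [NeZero ℓ₁] [NeZero ℓ₂] {ψ₁ : (ZMod ℓ₁)ˣ →* M}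
    {ψ₂ : (ZMod ℓ₂)ˣ →* M} {ξ₁ ξ₂ : B}
    (h : ∀ ε : M, ε ^ n = 1 → q ∣ gaussPeriod ψ₁ ξ₁ ε - gaussPeriod ψ₂ ξ₂ ε) :
    (periodPoly n ψ₁ ξ₁).map (Ideal.Quotient.mk (Ideal.span {q})) =
      (periodPoly n ψ₂ ξ₂).map (Ideal.Quotient.mk (Ideal.span {q})) := by
  simp only [periodPoly, Polynomial.map_prod, Polynomial.map_sub, map_X, map_C]
  refine Finset.prod_congr rfl fun ε hε => ?_
  rw [mem_nthRootsFinset (NeZero.pos n)] at hε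
  rw [Ideal.Quotient.eq.mpr (Ideal.mem_span_singleton.mpr (h ε hε))]

section Congruence

variable {p ℓ₁ ℓ₂ : ℕ} [hp : Fact p.Prime] [Fact ℓ₁.Prime] [Fact ℓ₂.Prime]

theorem natCast_dvd_gaussPeriod_sub_of_sub_one_pow_dvd {B M : Type*} [CommRing B] [IsDomain B]
    [CommRing M] [IsDomain M] {ψ₁ : (ZMod ℓ₁)ˣ →* M} (hψ₁ : orderOf ψ₁ = p)
    {ψ₂ : (ZMod ℓ₂)ˣ →* M} (hψ₂ : orderOf ψ₂ = p) {ω : M} (hω : IsPrimitiveRoot ω p) {ζ ξ₁ ξ₂ : B}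
    (hζ : IsPrimitiveRoot ζ p) (hξ₁ : IsPrimitiveRoot ξ₁ ℓ₁) (hξ₂ : IsPrimitiveRoot ξ₂ ℓ₂)
    (hdvd : (ζ - 1) ^ p ∣ ∑ i ∈ Finset.range p,
      ζ ^ i * (gaussPeriod ψ₁ ξ₁ (ω ^ i) - gaussPeriod ψ₂ ξ₂ (ω ^ i))) {ε : M} (hε : ε ^ p = 1) :
    (p : B) ∣ gaussPeriod ψ₁ ξ₁ ε - gaussPeriod ψ₂ ξ₂ ε := by
  let c (i : ℕ) : Algebra.adjoin ℤ {ξ₁, ξ₂} :=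
    ⟨gaussPeriod ψ₁ ξ₁ (ω ^ i), gaussPeriod_mem_adjoin ψ₁ (by simp) _⟩ -
      ⟨gaussPeriod ψ₂ ξ₂ (ω ^ i), gaussPeriod_mem_adjoin ψ₂ (by simp) _⟩
  have hsum : ∑ i ∈ Finset.range p, c i = 0 := by
    apply Subtype.ext
    simp only [c, AddSubmonoidClass.coe_finsetSum, AddSubgroupClass.coe_sub, Finset.sum_sub_distrib,
      ZeroMemClass.coe_zero]
    rw [← sum_nthRootsFinset_one_eq_sum_range hω (gaussPeriod ψ₁ ξ₁),
      ← sum_nthRootsFinset_one_eq_sum_range hω (gaussPeriod ψ₂ ξ₂),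
      sum_gaussPeriod (hψ₁ ▸ pow_orderOf_eq_one ψ₁) hξ₁,
      sum_gaussPeriod (hψ₂ ▸ pow_orderOf_eq_one ψ₂) hξ₂, sub_self]
  have hcop : p.Coprime (ℓ₁ * ℓ₂) :=
    (coprime_of_orderOf_eq hψ₁).mul_right (coprime_of_orderOf_eq hψ₂)
  have hroot : ∀ s ∈ ({ξ₁, ξ₂} : Set B), s ^ (ℓ₁ * ℓ₂) = 1 := by
    rintro s (rfl | rfl)
    · rw [pow_mul, hξ₁.pow_eq_one, one_pow]
    · rw [pow_mul', hξ₂.pow_eq_one, one_pow]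
  have hπ : (p : B) ∣ (ζ - 1) ^ p :=
    (associated_sub_one_pow_prime hζ).symm.dvd.trans (pow_dvd_pow _ (Nat.sub_le p 1))
  obtain ⟨i, hi, rfl⟩ := hω.eq_pow_of_pow_eq_one hε
  exact natCast_dvd_algebraMap_of_sub_one_pow_dvd_sum hζ
    (fun a => natCast_dvd_of_dvd_of_mem_adjoin hcop hroot hπ a.2) hsum hdvd hi

variable {Ω : Type*} [Field Ω]

theorem ringOfIntegers_eq_neg_sum_gaussPeriod {ζ : 𝓞 Ω} (hζ : IsPrimitiveRoot (ζ : Ω) p)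
    {ψ : (ZMod ℓ₁)ˣ →* Ω} (hψ : ψ ^ p = 1) {ξ t : 𝓞 Ω} (ht : (t : Ω) = tau ψ ξ) :
    t = -∑ i ∈ Finset.range p, ζ ^ i * gaussPeriod ψ ξ ((ζ : Ω) ^ i) := by
  apply RingOfIntegers.ext
  rw [ht, tau_eq_neg_sum_gaussPeriod hψ,
    sum_nthRootsFinset_one_eq_sum_range hζ fun ε => ε * gaussPeriod ψ (ξ : Ω) ε]
  simp [map_gaussPeriod]

variable [CharZero Ω]

theorem not_isUnit_natCast_ringOfIntegers : ¬ IsUnit (p : 𝓞 Ω) := by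
  intro h
  have hℤ : IsUnit (algebraMap ℤ (𝓞 Ω) p) := by simpa using h
  exact (Nat.prime_iff_prime_int.mp hp.out).not_isUnit (isUnit_of_map_unit _ _ hℤ)

theorem map_intPoly_ringOfIntegers_eq_periodPoly {ξ : Ω} (hξ : IsPrimitiveRoot ξ ℓ₁)
    {F : IntermediateField ℚ ℚ⟮ξ⟯} (hF : Module.finrank ℚ F = p) {ψ : (ZMod ℓ₁)ˣ →* Ω}
    (hψ : orderOf ψ = p) {ξ' : 𝓞 Ω} (hξ' : IsPrimitiveRoot (ξ' : Ω) ℓ₁) :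
    (intPoly ξ F).map (Int.castRingHom (𝓞 Ω)) = periodPoly p ψ ξ' := by
  apply Polynomial.map_injective _ (FaithfulSMul.algebraMap_injective (𝓞 Ω) Ω)
  rw [Polynomial.map_map, RingHom.ext_int (RingHom.comp _ _) (Int.castRingHom Ω), map_periodPoly,
    map_intPoly_eq_periodPoly hξ hF hψ hξ']

theorem redPoly_eq_of_sub_one_pow_dvd_tau_sub {ξ₁ ξ₂ : Ω} (hξ₁ : IsPrimitiveRoot ξ₁ ℓ₁)
    (hξ₂ : IsPrimitiveRoot ξ₂ ℓ₂) {F₁ : IntermediateField ℚ ℚ⟮ξ₁⟯} (hF₁ : Module.finrank ℚ F₁ = p)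
    {F₂ : IntermediateField ℚ ℚ⟮ξ₂⟯} (hF₂ : Module.finrank ℚ F₂ = p) {ψ₁ : (ZMod ℓ₁)ˣ →* Ω}
    (hψ₁ : orderOf ψ₁ = p) {ψ₂ : (ZMod ℓ₂)ˣ →* Ω} (hψ₂ : orderOf ψ₂ = p) {ζ ξ₁' ξ₂' t₁ t₂ : 𝓞 Ω}
    (hζ : IsPrimitiveRoot (ζ : Ω) p) (hξ₁' : IsPrimitiveRoot (ξ₁' : Ω) ℓ₁)
    (hξ₂' : IsPrimitiveRoot (ξ₂' : Ω) ℓ₂) (ht₁ : (t₁ : Ω) = tau ψ₁ ξ₁')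
    (ht₂ : (t₂ : Ω) = tau ψ₂ ξ₂') (hdvd : (ζ - 1) ^ p ∣ t₂ - t₁) :
    redPoly p ξ₁ F₁ = redPoly p ξ₂ F₂ := by
  have hinj := FaithfulSMul.algebraMap_injective (𝓞 Ω) Ω
  have hsub : t₂ - t₁ = ∑ i ∈ Finset.range p,
      ζ ^ i * (gaussPeriod ψ₁ ξ₁' ((ζ : Ω) ^ i) - gaussPeriod ψ₂ ξ₂' ((ζ : Ω) ^ i)) := by
    rw [ringOfIntegers_eq_neg_sum_gaussPeriod hζ (hψ₁ ▸ pow_orderOf_eq_one ψ₁) ht₁,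
      ringOfIntegers_eq_neg_sum_gaussPeriod hζ (hψ₂ ▸ pow_orderOf_eq_one ψ₂) ht₂, neg_sub_neg,
      ← Finset.sum_sub_distrib]
    exact Finset.sum_congr rfl fun i _ => (mul_sub _ _ _).symm
  have hperiods : ∀ ε : Ω, ε ^ p = 1 →
      (p : 𝓞 Ω) ∣ gaussPeriod ψ₁ ξ₁' ε - gaussPeriod ψ₂ ξ₂' ε := fun ε hε =>
    natCast_dvd_gaussPeriod_sub_of_sub_one_pow_dvd hψ₁ hψ₂ hζ (.of_map_of_injective hζ hinj)
      (.of_map_of_injective hξ₁' hinj) (.of_map_of_injective hξ₂' hinj) (hsub ▸ hdvd) hε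
  have hpoly := map_periodPoly_quotient_eq_of_forall_dvd hperiods
  rw [← map_intPoly_ringOfIntegers_eq_periodPoly hξ₁ hF₁ hψ₁ hξ₁',
    ← map_intPoly_ringOfIntegers_eq_periodPoly hξ₂ hF₂ hψ₂ hξ₂', Polynomial.map_map,
    Polynomial.map_map, RingHom.ext_int (RingHom.comp _ _) (Int.castRingHom _)] at hpoly
  exact map_zmod_eq_of_map_quotient_eq not_isUnit_natCast_ringOfIntegers hpoly

end Congruence

section RingOfIntegers

variable {Ω : Type*} [Field Ω] [CharZero Ω]

theorem eq_span_toInteger_sub_one {p : ℕ} [hp : Fact p.Prime] {ζ : Ω} (hζ : IsPrimitiveRoot ζ p)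
    (𝔭 : Ideal (𝓞 ℚ⟮ζ⟯)) [h𝔭 : 𝔭.IsPrime] (hp𝔭 : (p : 𝓞 ℚ⟮ζ⟯) ∈ 𝔭) :
    𝔭 = Ideal.span {(isPrimitiveRoot_adjoinSimple_gen (K := ℚ) hζ).toInteger - 1} := by
  have : IsCyclotomicExtension {p} ℚ ℚ⟮ζ⟯ := isCyclotomicExtension_adjoin_simple hζ
  have : NumberField ℚ⟮ζ⟯ := IsCyclotomicExtension.numberField {p} ℚ _
  have : 𝔭.LiesOver (Ideal.span {(p : ℤ)}) := by
    refine ⟨(Int.ideal_span_isMaximal_of_prime p).eq_of_le (Ideal.IsPrime.ne_top inferInstance) ?_⟩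
    rw [Ideal.span_singleton_le_iff_mem, Ideal.mem_comap]
    simpa using hp𝔭
  exact IsCyclotomicExtension.Rat.eq_span_zeta_sub_one_of_liesOver' p _ _ 𝔭

theorem sub_one_pow_dvd_algebraMap_of_mem_map {p : ℕ} [Fact p.Prime] {ζ : Ω}
    (hζ : IsPrimitiveRoot ζ p) {𝔭 : Ideal (𝓞 ℚ⟮ζ⟯)} (h𝔭 : 𝔭.IsPrime) (hp𝔭 : (p : 𝓞 ℚ⟮ζ⟯) ∈ 𝔭)
    {E : IntermediateField ℚ Ω} (hζE : ℚ⟮ζ⟯ ≤ E) {n : ℕ} {x : 𝓞 E}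
    (hx : x ∈ (𝔭 ^ n).map (RingOfIntegers.mapRingHom (IntermediateField.inclusion hζE))) :
    (hζ.toInteger - 1) ^ n ∣ algebraMap (𝓞 E) (𝓞 Ω) x := by
  have hx' := Ideal.mem_map_of_mem (algebraMap (𝓞 E) (𝓞 Ω)) hx
  rw [Ideal.map_map, Ideal.map_pow, eq_span_toInteger_sub_one hζ 𝔭 hp𝔭, Ideal.map_span,
    Set.image_singleton, Ideal.span_singleton_pow, Ideal.mem_span_singleton, map_sub,
    map_one] at hx'
  exact hx'

theorem exists_ringOfIntegers_coe_eq_tau {p ℓ : ℕ} [Fact p.Prime] [Fact ℓ.Prime] {ζ ξ : Ω}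
    (hζ : IsPrimitiveRoot ζ p) (hξ : IsPrimitiveRoot ξ ℓ) {F : IntermediateField ℚ ℚ⟮ξ⟯}
    (hF : Module.finrank ℚ F = p) {ψ : (ZMod ℓ)ˣ →* Ω} (hψ : orderOf ψ = p)
    {E : IntermediateField ℚ Ω} (hζE : ζ ∈ E) (hFE : IntermediateField.lift F ≤ E) :
    ∃ t : 𝓞 E, ((t : E) : Ω) = tau ψ ξ :=
  ⟨⟨⟨tau ψ ξ, tau_mem hζ hξ hF hψ hζE hFE⟩,
    (isIntegral_algebraMap_iff (algebraMap E Ω).injective).mp (isIntegral_tau ψ hξ.pow_eq_one)⟩,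
    rfl⟩

theorem aeval_minpoly_apply_eq_zero {E : IntermediateField ℚ Ω} (σ : Gal(E/ℚ)) (x : E) :
    aeval (σ x : Ω) (minpoly ℚ (x : Ω)) = 0 := by
  have hmin : minpoly ℚ (x : Ω) = minpoly ℚ x := minpoly.algHom_eq E.val E.val.injective x
  rw [hmin]
  exact minpoly.aeval_algHom ℚ (E.val.comp σ.toAlgHom) x

end RingOfIntegers

theorem proposition5p3_general {Ω : Type*} [Field Ω] [CharZero Ω] (p : ℕ) [Fact p.Prime] (ζ : Ω)
    (hζ : IsPrimitiveRoot ζ p) (𝔭 : Ideal (𝓞 ℚ⟮ζ⟯)) (h𝔭 : 𝔭.IsPrime) (hp𝔭 : (p : 𝓞 ℚ⟮ζ⟯) ∈ 𝔭)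
    (ℓ₁ ℓ₂ : ℕ) [Fact ℓ₁.Prime] [Fact ℓ₂.Prime] (ξ₁ ξ₂ : Ω) (hξ₁ : IsPrimitiveRoot ξ₁ ℓ₁)
    (hξ₂ : IsPrimitiveRoot ξ₂ ℓ₂) (F₁ : IntermediateField ℚ ℚ⟮ξ₁⟯) (hF₁ : Module.finrank ℚ F₁ = p)
    (F₂ : IntermediateField ℚ ℚ⟮ξ₂⟯) (hF₂ : Module.finrank ℚ F₂ = p) (E : IntermediateField ℚ Ω)
    (hζE : ℚ⟮ζ⟯ ≤ E) (hF₁E : IntermediateField.lift F₁ ≤ E) (hF₂E : IntermediateField.lift F₂ ≤ E)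
    (ψ₁ : (ZMod ℓ₁)ˣ →* Ω) (hψ₁ : orderOf ψ₁ = p) (ψ₂ : (ZMod ℓ₂)ˣ →* Ω) (hψ₂ : orderOf ψ₂ = p) :
    ∃ t₁ t₂ : 𝓞 E, ((t₁ : E) : Ω) = tau ψ₁ ξ₁ ∧ ((t₂ : E) : Ω) = tau ψ₂ ξ₂ ∧
      (redPoly p ξ₁ F₁ ≠ redPoly p ξ₂ F₂ → ∀ σ : Gal(E/ℚ), t₂ - σ • t₁ ∉
        (𝔭 ^ p).map (RingOfIntegers.mapRingHom (IntermediateField.inclusion hζE))) := by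
  have hζ_mem : ζ ∈ E := hζE (mem_adjoin_simple_self ℚ ζ)
  obtain ⟨t₁, ht₁⟩ : ∃ t : 𝓞 E, ((t : E) : Ω) = tau ψ₁ ξ₁ :=
    exists_ringOfIntegers_coe_eq_tau hζ hξ₁ hF₁ hψ₁ hζ_mem hF₁E
  obtain ⟨t₂, ht₂⟩ : ∃ t : 𝓞 E, ((t : E) : Ω) = tau ψ₂ ξ₂ :=
    exists_ringOfIntegers_coe_eq_tau hζ hξ₂ hF₂ hψ₂ hζ_mem hF₂E
  refine ⟨t₁, t₂, ht₁, ht₂, fun hne σ hmem => hne ?_⟩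
  obtain ⟨ψ', ξ', hψ', hξ', hconj⟩ : ∃ (ψ' : (ZMod ℓ₁)ˣ →* Ω) (ξ' : Ω),
      orderOf ψ' = orderOf ψ₁ ∧ IsPrimitiveRoot ξ' ℓ₁ ∧ (σ t₁ : Ω) = tau ψ' ξ' :=
    exists_eq_tau_of_aeval_minpoly_eq_zero (K := ℚ) ψ₁ hξ₁ (ht₁ ▸ aeval_minpoly_apply_eq_zero σ t₁)
  have hdvd := sub_one_pow_dvd_algebraMap_of_mem_map hζ h𝔭 hp𝔭 hζE hmem
  rw [map_sub] at hdvd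
  exact redPoly_eq_of_sub_one_pow_dvd_tau_sub hξ₁ hξ₂ hF₁ hF₂ (hψ'.trans hψ₁) hψ₂
    (ζ := hζ.toInteger) (ξ₁' := hξ'.toInteger) (ξ₂' := hξ₂.toInteger)
    (t₁ := algebraMap (𝓞 E) (𝓞 Ω) (σ • t₁)) (t₂ := algebraMap (𝓞 E) (𝓞 Ω) t₂)
    hζ hξ' hξ₂ hconj ht₂ hdvd

theorem proposition5p3 {Ω : Type*} [Field Ω] [CharZero Ω]
    -- an odd prime `p`, a primitive `p`-th root of unity `ζ`, and `K = ℚ(ζ)`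
    (p : ℕ) [Fact p.Prime] (hp : p ≠ 2) (ζ : Ω) (hζ : IsPrimitiveRoot ζ p)
    -- the prime ideal of `K` above `p`
    (𝔭 : Ideal (𝓞 ℚ⟮ζ⟯)) (h𝔭 : 𝔭.IsPrime) (hp𝔭 : (p : 𝓞 ℚ⟮ζ⟯) ∈ 𝔭)
    -- two primes congruent to 1 modulo `p`, with primitive roots of unity of these orders
    (ℓ₁ ℓ₂ : ℕ) [Fact ℓ₁.Prime] [Fact ℓ₂.Prime] (hℓ₁ : ℓ₁ ≡ 1 [MOD p]) (hℓ₂ : ℓ₂ ≡ 1 [MOD p])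
    (ξ₁ ξ₂ : Ω) (hξ₁ : IsPrimitiveRoot ξ₁ ℓ₁) (hξ₂ : IsPrimitiveRoot ξ₂ ℓ₂)
    -- the subfields of degree `p` of `ℚ(ξ₁)` and `ℚ(ξ₂)`
    (F₁ : IntermediateField ℚ ℚ⟮ξ₁⟯) (hF₁ : Module.finrank ℚ F₁ = p)
    (F₂ : IntermediateField ℚ ℚ⟮ξ₂⟯) (hF₂ : Module.finrank ℚ F₂ = p)
    -- primitive roots modulo the two primes, and the characters sending them to `ζ`
    (g₁ : (ZMod ℓ₁)ˣ) (hg₁ : ∀ x, x ∈ Subgroup.zpowers g₁)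
    (g₂ : (ZMod ℓ₂)ˣ) (hg₂ : ∀ x, x ∈ Subgroup.zpowers g₂)
    (ψ₁ : (ZMod ℓ₁)ˣ →* Ω) (hψ₁ : ψ₁ g₁ = ζ) (ψ₂ : (ZMod ℓ₂)ˣ →* Ω) (hψ₂ : ψ₂ g₂ = ζ) :
    -- the Gauss sums are algebraic integers of `F₁F₂K`, and the non-congruence holds there
    ∃ t₁ t₂ : 𝓞 (compositumFK ζ F₁ F₂),
      ((t₁ : compositumFK ζ F₁ F₂) : Ω) = tau ψ₁ ξ₁ ∧
      ((t₂ : compositumFK ζ F₁ F₂) : Ω) = tau ψ₂ ξ₂ ∧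
      (redPoly p ξ₁ F₁ ≠ redPoly p ξ₂ F₂ →
        ∀ σ : Gal(compositumFK ζ F₁ F₂/ℚ),
          t₂ - σ • t₁ ∉ (𝔭 ^ p).map (inclFK ζ F₁ F₂)) := by
  exact proposition5p3_general p ζ hζ 𝔭 h𝔭 hp𝔭 ℓ₁ ℓ₂ ξ₁ ξ₂ hξ₁ hξ₂ F₁ hF₁ F₂ hF₂ _ le_sup_right
    (le_sup_left.trans le_sup_left) (le_sup_right.trans le_sup_left)
    ψ₁ (by rw [orderOf_monoidHom_eq_orderOf_apply hg₁, hψ₁, hζ.eq_orderOf])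
    ψ₂ (by rw [orderOf_monoidHom_eq_orderOf_apply hg₂, hψ₂, hζ.eq_orderOf])
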